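/- A (finite) hypergraph $H$ consists of a finite set $V(H)$ of vertices and a set $E(H) \subseteq 2^{V(H)}$ of edges; its size is $\|H\| = |V(H)| + |E(H)|$. A nest-set of $H$ is a non-empty set $s \subseteq V(H)$ such that $\{\, e \setminus s \mid e \in E(H),\ e \cap s \neq \emptyset \,\}$ is linearly ordered by $\subseteq$; it is a $k$-nest-set if $|s| \le k$. Theorem 5.6. There is an algorithm that takes as input a hypergraph $H$ and an integer $k \ge 1$, runs in time $2^{O(k^2)} \cdot \mathrm{poly}(\|H\|)$, and returns a $k$-nest-set of $H$ if one exists, and rejects otherwise. -/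

import Mathlib

/-! ### Nest-sets of hypergraphs (on Mathlib's `Hypergraph`) -/

namespace Hypergraph

/-- `I(s, H)`: the edges of `H` that contain at least one vertex of `s`. -/
def incidentEdges {α : Type*} (H : Hypergraph α) (s : Set α) : Set (Set α) :=
  {e | e ∈ H.edgeSet ∧ ∃ v ∈ s, v ∈ e}

/-- The set `{e \ s | e ∈ I(s, H)}`. -/
def incidentRemainders {α : Type*} (H : Hypergraph α) (s : Set α) : Set (Set α) :=
  (fun e => e \ s) '' H.incidentEdges s

/-- A nest-set of `H`: a non-empty set `s` of vertices such that `{e \ s | e ∈ I(s, H)}` is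
linearly ordered by `⊆`. -/
structure IsNestSet {α : Type*} (H : Hypergraph α) (s : Set α) : Prop where
  nonempty : s.Nonempty
  subset : s ⊆ H.vertexSet
  chain : IsChain (fun a b : Set α => a ⊆ b) (H.incidentRemainders s)

/-- A `k`-nest-set of `H`: a nest-set with at most `k` elements. -/
def IsKNestSet {α : Type*} (H : Hypergraph α) (k : ℕ) (s : Set α) : Prop :=
  H.IsNestSet s ∧ s.encard ≤ k

/-- The size `‖H‖ = |V(H)| + |E(H)|` of a (finite) hypergraph. -/
noncomputable def size {α : Type*} (H : Hypergraph α) : ℕ :=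
  H.vertexSet.ncard + H.edgeSet.ncard

end Hypergraph

/-! ### Random access machines

Structured programs for a random access machine. The machine has registers, which a program
addresses by fixed numbers, and a memory, which it addresses indirectly through registers; both
hold natural numbers. The arithmetic is addition and truncated subtraction (there is no
multiplication, so that a number grows by at most one bit per step), and every instruction and
every test of a register costs one step. -/

namespace RAM

/-- A configuration of the machine: the contents of the registers and of the memory. -/
structure State where
  reg : ℕ → ℕ
  mem : ℕ → ℕ

/-- Programs. -/
inductive Prog where
  /-- do nothing -/
  | skip : Prog
  /-- `x := c` for a constant `c` -/
  | const (x c : ℕ) : Prog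
  /-- `x := y` -/
  | copy (x y : ℕ) : Prog
  /-- `x := y + z` -/
  | add (x y z : ℕ) : Prog
  /-- `x := max (y - z) 0` -/
  | sub (x y z : ℕ) : Prog
  /-- `x := mem[y]` -/
  | load (x y : ℕ) : Prog
  /-- `mem[x] := y` -/
  | store (x y : ℕ) : Prog
  /-- run the first program, then the second one -/
  | seq (p q : Prog) : Prog
  /-- run the first program if `x ≠ 0`, and the second one if `x = 0` -/
  | ifNZ (x : ℕ) (p q : Prog) : Prog
  /-- repeat the program as long as `x ≠ 0` -/
  | whileNZ (x : ℕ) (p : Prog) : Prog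

/-- Write the value `a` into register `x`. -/
def State.setReg (σ : State) (x a : ℕ) : State :=
  ⟨Function.update σ.reg x a, σ.mem⟩

/-- Write the value `a` into the memory cell with address `i`. -/
def State.setMem (σ : State) (i a : ℕ) : State :=
  ⟨σ.reg, Function.update σ.mem i a⟩

/-- `Exec p σ t τ`: the program `p`, started in `σ`, halts in `τ` after exactly `t` steps. -/
inductive Exec : Prog → State → ℕ → State → Prop where
  | skip (σ : State) : Exec .skip σ 1 σ
  | const (σ : State) (x c : ℕ) : Exec (.const x c) σ 1 (σ.setReg x c)
  | copy (σ : State) (x y : ℕ) : Exec (.copy x y) σ 1 (σ.setReg x (σ.reg y))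
  | add (σ : State) (x y z : ℕ) : Exec (.add x y z) σ 1 (σ.setReg x (σ.reg y + σ.reg z))
  | sub (σ : State) (x y z : ℕ) : Exec (.sub x y z) σ 1 (σ.setReg x (σ.reg y - σ.reg z))
  | load (σ : State) (x y : ℕ) : Exec (.load x y) σ 1 (σ.setReg x (σ.mem (σ.reg y)))
  | store (σ : State) (x y : ℕ) : Exec (.store x y) σ 1 (σ.setMem (σ.reg x) (σ.reg y))
  | seq {p q : Prog} {σ τ ρ : State} {t u : ℕ} (hp : Exec p σ t τ) (hq : Exec q τ u ρ) :
      Exec (.seq p q) σ (t + u) ρ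
  | ifNZ_true {x : ℕ} {p q : Prog} {σ τ : State} {t : ℕ} (hx : σ.reg x ≠ 0)
      (hp : Exec p σ t τ) : Exec (.ifNZ x p q) σ (t + 1) τ
  | ifNZ_false {x : ℕ} {p q : Prog} {σ τ : State} {t : ℕ} (hx : σ.reg x = 0)
      (hq : Exec q σ t τ) : Exec (.ifNZ x p q) σ (t + 1) τ
  | whileNZ_done {x : ℕ} {p : Prog} {σ : State} (hx : σ.reg x = 0) :
      Exec (.whileNZ x p) σ 1 σ
  | whileNZ_step {x : ℕ} {p : Prog} {σ τ ρ : State} {t u : ℕ} (hx : σ.reg x ≠ 0)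
      (hp : Exec p σ t τ) (hw : Exec (.whileNZ x p) τ u ρ) :
      Exec (.whileNZ x p) σ (t + u + 1) ρ

end RAM

/-! ### Input and output -/

namespace Hypergraph

open Classical in
/-- The initial configuration for the input `(H, k)`, where the vertices of `H` are listed as
`vs 0, …, vs (n - 1)` and the edges of `H` as `es 0, …, es (m - 1)`: registers `0`, `1`, `2` hold
`n`, `m`, `k`, and the memory holds the `m × n` incidence matrix of `H` row by row, i.e. cell
`i * n + j` holds `1` if `vs j ∈ es i`, and `0` if not. Everything else is `0`. -/
noncomputable def inputState {α : Type*} (H : Hypergraph α) {n m : ℕ}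
    (vs : Fin n ≃ H.vertexSet) (es : Fin m ≃ H.edgeSet) (k : ℕ) : RAM.State where
  reg x := if x = 0 then n else if x = 1 then m else if x = 2 then k else 0
  mem a := if ∃ (i : Fin m) (j : Fin n), a = i * n + j ∧ (vs j : α) ∈ (es i : Set α)
    then 1 else 0

/-- The final configuration `σ` rejects: register `0` holds `0`. -/
def Rejects (σ : RAM.State) : Prop := σ.reg 0 = 0

/-- The final configuration `σ` accepts and returns the set `s` of vertices: register `0` holds
`1`, and register `1` holds the address of an array of length `n` that is the characteristic
vector of `s` with respect to the list `vs` of the vertices of `H`. -/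
def Returns {α : Type*} (H : Hypergraph α) {n : ℕ} (vs : Fin n ≃ H.vertexSet)
    (σ : RAM.State) (s : Set α) : Prop :=
  σ.reg 0 = 1 ∧
    ∀ j : Fin n, ((vs j : α) ∈ s → σ.mem (σ.reg 1 + j) = 1) ∧
      ((vs j : α) ∉ s → σ.mem (σ.reg 1 + j) = 0)

end Hypergraph

/-!
A nest-set containing `s` cannot contain two edges in conflict over `s` (both meet `s`, and their
remainders outside `s` are incomparable) unless it contains one of the differences `e \ f` and
`f \ e`. So start from a single vertex and, as long as there is a conflict, add one of the two
differences, as prescribed by the next bit of a guess. Every addition makes the set larger, so the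
process ends in a nest-set; and some guess of `k` bits stays inside a given `k`-nest-set through
the starting vertex. Trying all vertices and all guesses takes `2 ^ k * poly(‖H‖)` steps.
-/

namespace NestSearch

open Set

/-! ### Folds of inflationary maps -/

section Fold

variable {X Y : Type*}

theorem foldr_closure {P : (X → X) → Prop} (id_mem : P id)
    (comp_mem : ∀ f g, P f → P g → P (f ∘ g)) {f : Y → X → X} {l : List Y}
    (hf : ∀ y ∈ l, P (f y)) : P fun a => l.foldr f a := by
  induction l with
  | nil => exact id_mem
  | cons y l ih =>
    exact comp_mem _ _ (hf y List.mem_cons_self) (ih fun z hz => hf z (List.mem_cons_of_mem y hz))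

theorem foldr_mapsTo {s : Set X} {f : Y → X → X} {l : List Y} (hf : ∀ y ∈ l, MapsTo (f y) s s) :
    MapsTo (fun a => l.foldr f a) s s :=
  foldr_closure (P := fun g => MapsTo g s s) (mapsTo_id s) (fun _ _ => MapsTo.comp) hf

variable [PartialOrder X]

theorem le_foldr {f : Y → X → X} (hf : ∀ y a, a ≤ f y a) (l : List Y) (a : X) :
    a ≤ l.foldr f a :=
  foldr_closure (P := fun g => ∀ a, a ≤ g a) (fun _ => le_rfl)
    (fun _ _ hf hg a => (hg a).trans (hf _)) (fun y _ => hf y) a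

theorem foldr_eq_self_iff {f : Y → X → X} (hf : ∀ y a, a ≤ f y a) {l : List Y} {a : X} :
    l.foldr f a = a ↔ ∀ y ∈ l, f y a = a := by
  induction l with
  | nil => simp
  | cons y l ih =>
    rw [List.foldr_cons, List.forall_mem_cons, ← ih]
    constructor
    · intro h
      have hl : l.foldr f a = a := le_antisymm ((hf y _).trans h.le) (le_foldr hf l a)
      exact ⟨by rwa [hl] at h, hl⟩
    · rintro ⟨hy, hl⟩
      rw [hl, hy]

theorem foldr_const_isFixedPt_or_le {f : X → X} {s : Set X} {h : X → ℕ} (hf : ∀ a, a ≤ f a)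
    (hs : MapsTo f s s) (hh : StrictMonoOn h s) {a : X} (ha : a ∈ s) (l : List Y) :
    Function.IsFixedPt f (l.foldr (fun _ => f) a) ∨
      h a + l.length ≤ h (l.foldr (fun _ => f) a) := by
  induction l with
  | nil => exact .inr le_rfl
  | cons y l ih =>
    set b := l.foldr (fun _ => f) a
    by_cases hb : Function.IsFixedPt f b
    · exact .inl (congrArg f hb)
    · have hbs : b ∈ s := foldr_mapsTo (fun _ _ => hs) ha
      have hlt : h b < h (f b) := hh hbs (hs hbs) ((hf b).lt_of_ne (Ne.symm hb))
      have hle := ih.resolve_left hb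
      refine .inr ?_
      change h a + (l.length + 1) ≤ h (f b)
      omega

end Fold

/-! ### The branching search -/

section Search

variable {α : Type*}

/-- Two edges are in conflict over `s` if both meet `s` and their remainders outside of `s` are
incomparable; a nest-set is a set of vertices without conflicts. -/
def Conflict (s e f : Set α) : Prop :=
  (e ∩ s).Nonempty ∧ (f ∩ s).Nonempty ∧ ((e \ f) \ s).Nonempty ∧ ((f \ e) \ s).Nonempty

theorem isChain_incidentRemainders_iff {H : Hypergraph α} {s : Set α} :
    IsChain (· ⊆ ·) (H.incidentRemainders s) ↔
      ∀ e ∈ H.edgeSet, ∀ f ∈ H.edgeSet, ¬ Conflict s e f := by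
  constructor
  · rintro h e he f hf ⟨⟨x, hxe, hxs⟩, ⟨y, hyf, hys⟩, ⟨p, ⟨hpe, hpf⟩, hps⟩, ⟨q, ⟨hqf, hqe⟩, hqs⟩⟩
    rcases h.total ⟨e, ⟨he, x, hxs, hxe⟩, rfl⟩ ⟨f, ⟨hf, y, hys, hyf⟩, rfl⟩ with hef | hfe
    · exact hpf (hef ⟨hpe, hps⟩).1
    · exact hqe (hfe ⟨hqf, hqs⟩).1
  · rintro h _ ⟨e, ⟨he, x, hxs, hxe⟩, rfl⟩ _ ⟨f, ⟨hf, y, hys, hyf⟩, rfl⟩ -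
    by_contra! hc
    obtain ⟨p, ⟨hpe, hps⟩, hpf⟩ := not_subset.1 hc.1
    obtain ⟨q, ⟨hqf, hqs⟩, hqe⟩ := not_subset.1 hc.2
    exact h e he f hf ⟨⟨x, hxe, hxs⟩, ⟨y, hyf, hys⟩, ⟨p, ⟨hpe, fun hp => hpf ⟨hp, hps⟩⟩, hps⟩,
      ⟨q, ⟨hqf, fun hq => hqe ⟨hq, hqs⟩⟩, hqs⟩⟩

theorem Conflict.sdiff_subset_or_sdiff_subset {s t e f : Set α} (h : Conflict s e f) (hst : s ⊆ t)
    (ht : ¬ Conflict t e f) : f \ e ⊆ t ∨ e \ f ⊆ t := by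
  by_contra! hc
  exact ht ⟨h.1.mono (inter_subset_inter_right e hst), h.2.1.mono (inter_subset_inter_right f hst),
    sdiff_nonempty.2 hc.2, sdiff_nonempty.2 hc.1⟩

/-- A stage of the search: the current set, and a number whose binary digits are the choices that
are still to be made. -/
structure Branch (α : Type*) where
  guess : ℕ
  set : Set α

/-- Going down in the search tree: only an extension of the set may change the guess. -/
instance : PartialOrder (Branch α) where
  le a b := a = b ∨ a.set ⊂ b.set
  le_refl _ := .inl rfl
  le_trans a b c := by
    rintro (rfl | hab) (rfl | hbc)
    exacts [.inl rfl, .inr hbc, .inr hab, .inr (hab.trans hbc)]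
  le_antisymm a b := by
    rintro (rfl | hab) (hba | hba)
    exacts [rfl, rfl, hba.symm, (hab.asymm hba).elim]

theorem Branch.set_mono : Monotone (Branch.set (α := α)) := by
  rintro a b (rfl | h)
  exacts [le_rfl, h.subset]

theorem Branch.set_strictMono : StrictMono (Branch.set (α := α)) := fun _ _ h =>
  h.le.resolve_left h.ne

theorem Branch.strictMonoOn_ncard {U : Set α} (hU : U.Finite) :
    StrictMonoOn (fun a : Branch α => a.set.ncard) {a | a.set ⊆ U} := fun _ _ _ hb h =>
  ncard_lt_ncard (set_strictMono h) (hU.subset hb)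

open Classical in
/-- If `e` and `f` are in conflict over the current set, add `f \ e` or `e \ f` to it. The leading
binary digit of the guess `g < W = 2 ^ k` decides, and the other digits move up: the digit is `1`
iff `W ≤ 2 * g`. -/
noncomputable def resolve (W : ℕ) (e f : Set α) (a : Branch α) : Branch α :=
  if Conflict a.set e f then
    if 2 * a.guess < W then ⟨2 * a.guess, a.set ∪ f \ e⟩ else ⟨2 * a.guess - W, a.set ∪ e \ f⟩
  else a

/-- Resolve the conflicts of all pairs of edges, one after the other. -/
noncomputable def sweep (W : ℕ) (L : List (Set α)) (a : Branch α) : Branch α :=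
  L.foldr (fun e a => L.foldr (resolve W e) a) a

/-- The outcome of the search with the starting vertex `v` and the guess `b`. As many sweeps as
there are vertices suffice to resolve all conflicts. -/
noncomputable def search (W : ℕ) (V : List α) (L : List (Set α)) (v : α) (b : ℕ) : Branch α :=
  V.foldr (fun _ => sweep W L) ⟨b, {v}⟩

variable {W : ℕ} {e f : Set α} {V : List α} {L : List (Set α)} {a : Branch α} {v : α} {b : ℕ}

theorem resolve_of_not_conflict (h : ¬ Conflict a.set e f) : resolve W e f a = a := if_neg h

theorem le_resolve (W : ℕ) (e f : Set α) (a : Branch α) : a ≤ resolve W e f a := by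
  by_cases h : Conflict a.set e f
  · obtain ⟨-, -, ⟨p, hp, hps⟩, ⟨q, hq, hqs⟩⟩ := id h
    rw [resolve, if_pos h]
    right
    split_ifs
    · exact ssubset_iff_subset_ne.2 ⟨subset_union_left, fun heq => hqs (heq ▸ .inr hq)⟩
    · exact ssubset_iff_subset_ne.2 ⟨subset_union_left, fun heq => hps (heq ▸ .inr hp)⟩
  · exact (resolve_of_not_conflict h).ge

theorem resolve_eq_self_iff : resolve W e f a = a ↔ ¬ Conflict a.set e f := by
  refine ⟨fun h hc => ?_, resolve_of_not_conflict⟩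
  obtain ⟨-, -, ⟨p, hp, hps⟩, ⟨q, hq, hqs⟩⟩ := id hc
  have hset := congrArg Branch.set h
  rw [resolve, if_pos hc] at hset
  split_ifs at hset
  · exact hqs (hset ▸ .inr hq)
  · exact hps (hset ▸ .inr hp)

theorem le_sweep (W : ℕ) (L : List (Set α)) (a : Branch α) : a ≤ sweep W L a :=
  le_foldr (fun e => le_foldr (le_resolve W e) L) L a

theorem sweep_eq_self_iff :
    sweep W L a = a ↔ ∀ e ∈ L, ∀ f ∈ L, ¬ Conflict a.set e f := by
  simp only [sweep, foldr_eq_self_iff fun e => le_foldr (le_resolve W e) L,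
    foldr_eq_self_iff (le_resolve W _), resolve_eq_self_iff]

theorem mapsTo_resolve {U : Set α} (he : e ⊆ U) (hf : f ⊆ U) :
    MapsTo (resolve W e f) {a | a.set ⊆ U} {a | a.set ⊆ U} := by
  intro a ha
  unfold resolve
  split_ifs
  · exact union_subset ha (sdiff_subset.trans hf)
  · exact union_subset ha (sdiff_subset.trans he)
  · exact ha

theorem mapsTo_sweep {U : Set α} (hL : ∀ e ∈ L, e ⊆ U) :
    MapsTo (sweep W L) {a | a.set ⊆ U} {a | a.set ⊆ U} :=
  foldr_mapsTo fun e he => foldr_mapsTo fun f hf => mapsTo_resolve (hL e he) (hL f hf)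

theorem mem_search (W : ℕ) (V : List α) (L : List (Set α)) (v : α) (b : ℕ) :
    v ∈ (search W V L v b).set :=
  Branch.set_mono (le_foldr (fun _ => le_sweep W L) V ⟨b, {v}⟩) (mem_singleton v)

theorem search_subset {U : Set α} (hL : ∀ e ∈ L, e ⊆ U) (hv : v ∈ U) :
    (search W V L v b).set ⊆ U :=
  foldr_mapsTo (s := {a : Branch α | a.set ⊆ U}) (fun _ _ => mapsTo_sweep hL)
    (singleton_subset_iff.2 hv)

theorem sweep_search (hL : ∀ e ∈ L, e ⊆ {x | x ∈ V}) (hv : v ∈ V) :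
    sweep W L (search W V L v b) = search W V L v b := by
  classical
  have hV : {x | x ∈ V} = (V.toFinset : Set α) := by simp
  refine (foldr_const_isFixedPt_or_le (le_sweep W L) (mapsTo_sweep hL)
    (Branch.strictMonoOn_ncard V.finite_toSet) (a := ⟨b, {v}⟩)
    (singleton_subset_iff.2 hv) V).resolve_right fun hlen => ?_
  have hcard : (search W V L v b).set.ncard ≤ V.length :=
    calc (search W V L v b).set.ncard ≤ {x | x ∈ V}.ncard :=
          ncard_le_ncard (search_subset hL hv) V.finite_toSet
      _ = V.toFinset.card := by rw [hV, ncard_coe_finset]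
      _ ≤ V.length := V.toFinset_card_le
  rw [ncard_singleton] at hlen
  exact absurd (hlen.trans hcard) (by omega)

/-! ### A guess that stays inside a given nest-set -/

/-- The set of the branch lies in `s`, and only the first `|s \ a.set|` of the `k` binary digits
of the guess may be nonzero. -/
structure Fits (k : ℕ) (s : Set α) (a : Branch α) : Prop where
  subset : a.set ⊆ s
  lt : a.guess < 2 ^ k
  dvd : 2 ^ (k - (s \ a.set).ncard) ∣ a.guess

/-- For suitable guesses `F` leads from subsets of `s` to subsets of `s`. The guesses are found
backwards: any guess `g'` that fits after `F` comes from a guess `g` that fits before. -/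
def Steers (k : ℕ) (s : Set α) (F : Branch α → Branch α) : Prop :=
  ∀ S ⊆ s, ∃ S' ⊆ s, ∀ g', Fits k s ⟨g', S'⟩ → ∃ g, Fits k s ⟨g, S⟩ ∧ F ⟨g, S⟩ = ⟨g', S'⟩

theorem steers_id (k : ℕ) (s : Set α) : Steers k s id := fun S hS =>
  ⟨S, hS, fun g hg => ⟨g, hg, rfl⟩⟩

theorem Steers.comp {k : ℕ} {s : Set α} (F G : Branch α → Branch α) (hF : Steers k s F)
    (hG : Steers k s G) : Steers k s (F ∘ G) := by
  intro S hS
  obtain ⟨S', hS', hG⟩ := hG S hS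
  obtain ⟨S'', hS'', hF⟩ := hF S' hS'
  refine ⟨S'', hS'', fun g'' hg'' => ?_⟩
  obtain ⟨g', hg', hFg⟩ := hF g'' hg''
  obtain ⟨g, hg, hGg⟩ := hG g' hg'
  exact ⟨g, hg, by rw [Function.comp_apply, hGg, hFg]⟩

theorem exists_prepend_digit {k d d' c g' : ℕ} (hd' : d' < d) (hd : d ≤ k)
    (hg' : 2 ^ (k - d') ∣ g') : ∃ g, 2 * g = c * 2 ^ k + g' ∧ 2 ^ (k - d) ∣ g := by
  obtain ⟨q, rfl⟩ := hg'
  obtain ⟨r, rfl⟩ := Nat.exists_eq_add_of_lt hd'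
  obtain ⟨l, rfl⟩ := Nat.exists_eq_add_of_le hd
  refine ⟨2 ^ l * (c * 2 ^ (d' + r) + 2 ^ r * q), ?_, ?_⟩
  · rw [show d' + r + 1 + l - d' = r + 1 + l by omega]
    ring
  · rw [Nat.add_sub_cancel_left]
    exact dvd_mul_right _ _

theorem Fits.exists_prepend_digit {k c g' : ℕ} {s S D : Set α} (hs : s.Finite) (hk : s.ncard ≤ k)
    (hS : S ⊆ s) (hD : (D \ S).Nonempty) (hc : c < 2) (h : Fits k s ⟨g', S ∪ D⟩) :
    ∃ g, 2 * g = c * 2 ^ k + g' ∧ Fits k s ⟨g, S⟩ := by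
  obtain ⟨x, hxD, hxS⟩ := hD
  have hlt : (s \ (S ∪ D)).ncard < (s \ S).ncard :=
    ncard_lt_ncard (ssubset_iff_of_subset (sdiff_subset_sdiff_right subset_union_left) |>.2
      ⟨x, ⟨h.subset (.inr hxD), hxS⟩, fun hx => hx.2 (.inr hxD)⟩) hs.sdiff
  obtain ⟨g, hg, hdvd⟩ := NestSearch.exists_prepend_digit (c := c) hlt
    ((ncard_le_ncard sdiff_subset hs).trans hk) h.dvd
  have hg' : g' < 2 ^ k := h.lt
  have hdigit : c * 2 ^ k ≤ 1 * 2 ^ k := Nat.mul_le_mul_right _ (Nat.le_of_lt_succ hc)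
  have hlt : g < 2 ^ k := by linarith
  exact ⟨g, hg, hS, hlt, hdvd⟩

theorem steers_resolve {k : ℕ} {s : Set α} (hs : s.Finite) (hk : s.ncard ≤ k)
    (h : ¬ Conflict s e f) : Steers k s (resolve (2 ^ k) e f) := by
  intro S hS
  by_cases hc : Conflict S e f
  · have hfe : ((f \ e) \ S).Nonempty := hc.2.2.2
    have hef : ((e \ f) \ S).Nonempty := hc.2.2.1
    rcases hc.sdiff_subset_or_sdiff_subset hS h with hD | hD
    · refine ⟨S ∪ f \ e, union_subset hS hD, fun g' hg' => ?_⟩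
      obtain ⟨g, hg, hfit⟩ := hg'.exists_prepend_digit (c := 0) hs hk hS hfe (by norm_num)
      have hlt : g' < 2 ^ k := hg'.lt
      rw [zero_mul, zero_add] at hg
      exact ⟨g, hfit, by simp [resolve, hc, hg, hlt]⟩
    · refine ⟨S ∪ e \ f, union_subset hS hD, fun g' hg' => ?_⟩
      obtain ⟨g, hg, hfit⟩ := hg'.exists_prepend_digit (c := 1) hs hk hS hef (by norm_num)
      exact ⟨g, hfit, by simp [resolve, hc, hg]⟩
  · exact ⟨S, hS, fun g hg => ⟨g, hg, resolve_of_not_conflict hc⟩⟩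

theorem exists_search_subset {k : ℕ} {s : Set α} (hs : s.Finite) (hk : s.ncard ≤ k)
    (hL : ∀ e ∈ L, ∀ f ∈ L, ¬ Conflict s e f) (V : List α) (hv : v ∈ s) :
    ∃ b < 2 ^ k, (search (2 ^ k) V L v b).set ⊆ s := by
  have hsweep : Steers k s (sweep (2 ^ k) L) :=
    foldr_closure (steers_id k s) Steers.comp fun e he =>
      foldr_closure (steers_id k s) Steers.comp fun f hf => steers_resolve hs hk (hL e he f hf)
  have hsearch : Steers k s fun a => V.foldr (fun _ => sweep (2 ^ k) L) a :=
    foldr_closure (steers_id k s) Steers.comp fun _ _ => hsweep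
  obtain ⟨S', hS', hguess⟩ := hsearch {v} (singleton_subset_iff.2 hv)
  obtain ⟨b, hb, hrun⟩ := hguess 0 ⟨hS', by positivity, dvd_zero _⟩
  exact ⟨b, hb.lt, (congrArg Branch.set hrun).trans_subset hS'⟩

/-- `V` lists the vertices of `H` without repetitions, and `L` lists the edges. -/
structure Listing (H : Hypergraph α) (V : List α) (L : List (Set α)) : Prop where
  nodup : V.Nodup
  mem_vertices : ∀ {x}, x ∈ V ↔ x ∈ H.vertexSet
  mem_edges : ∀ {e}, e ∈ L ↔ e ∈ H.edgeSet

namespace Listing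

variable {H : Hypergraph α} {k : ℕ}

theorem edge_subset (h : Listing H V L) (he : e ∈ L) : e ⊆ {x | x ∈ V} := fun _ hx =>
  h.mem_vertices.2 (H.subset_vertexSet_of_mem_edgeSet' (h.mem_edges.1 he) hx)

theorem search_subset (h : Listing H V L) (hv : v ∈ V) : (search W V L v b).set ⊆ {x | x ∈ V} :=
  NestSearch.search_subset (fun _ => h.edge_subset) hv

theorem isNestSet_search (h : Listing H V L) (hv : v ∈ V) :
    H.IsNestSet (search W V L v b).set where
  nonempty := ⟨v, mem_search W V L v b⟩
  subset := fun _ hx => h.mem_vertices.1 (h.search_subset hv hx)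
  chain := isChain_incidentRemainders_iff.2 fun e he f hf =>
    sweep_eq_self_iff.1 (sweep_search (fun _ => h.edge_subset) hv) e (h.mem_edges.2 he) f
      (h.mem_edges.2 hf)

theorem isKNestSet_search_iff (h : Listing H V L) (hv : v ∈ V) :
    H.IsKNestSet k (search W V L v b).set ↔ (search W V L v b).set.ncard ≤ k := by
  have hfin : (search W V L v b).set.Finite := V.finite_toSet.subset (h.search_subset hv)
  rw [Hypergraph.IsKNestSet, and_iff_right (h.isNestSet_search hv), ← hfin.cast_ncard_eq,
    Nat.cast_le]

theorem exists_isKNestSet_iff (h : Listing H V L) :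
    (∃ s, H.IsKNestSet k s) ↔
      ∃ v ∈ V, ∃ b < 2 ^ k, H.IsKNestSet k (search (2 ^ k) V L v b).set := by
  refine ⟨?_, fun ⟨v, _, b, _, hs⟩ => ⟨_, hs⟩⟩
  rintro ⟨s, hs, hk⟩
  obtain ⟨v, hv⟩ := hs.nonempty
  have hvV := h.mem_vertices.2 (hs.subset hv)
  have hfin : s.Finite := finite_of_encard_le_coe hk
  rw [← hfin.cast_ncard_eq, Nat.cast_le] at hk
  obtain ⟨b, hb, hsub⟩ := exists_search_subset hfin hk (fun e he f hf =>
    isChain_incidentRemainders_iff.1 hs.chain e (h.mem_edges.1 he) f (h.mem_edges.1 hf)) V hv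
  exact ⟨v, hvV, b, hb, (h.isKNestSet_search_iff hvV).2 ((ncard_le_ncard hsub hfin).trans hk)⟩

end Listing

end Search

end NestSearch


local infixr:60 "⨟" => RAM.Prog.seq

namespace RAM

open Set

/-! ### Running times of programs -/

/-- The program `p`, started in `σ`, halts with a number of steps and a state that satisfy `Q`. -/
def wp (p : Prog) (Q : ℕ → State → Prop) (σ : State) : Prop :=
  ∃ t τ, Exec p σ t τ ∧ Q t τ

section

variable {p q : Prog} {Q Q' : ℕ → State → Prop} {σ τ : State} {x y z c a t b : ℕ}

theorem wp.mono (h : wp p Q σ) (hQ : ∀ t τ, Q t τ → Q' t τ) : wp p Q' σ :=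
  let ⟨t, τ, hp, h⟩ := h
  ⟨t, τ, hp, hQ t τ h⟩

@[simp] theorem wp_skip : wp .skip Q σ ↔ Q 1 σ :=
  ⟨by rintro ⟨_, _, ⟨⟩, h⟩; exact h, fun h => ⟨_, _, .skip σ, h⟩⟩

@[simp] theorem wp_const : wp (.const x c) Q σ ↔ Q 1 (σ.setReg x c) :=
  ⟨by rintro ⟨_, _, ⟨⟩, h⟩; exact h, fun h => ⟨_, _, .const σ x c, h⟩⟩

@[simp] theorem wp_copy : wp (.copy x y) Q σ ↔ Q 1 (σ.setReg x (σ.reg y)) :=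
  ⟨by rintro ⟨_, _, ⟨⟩, h⟩; exact h, fun h => ⟨_, _, .copy σ x y, h⟩⟩

@[simp] theorem wp_add : wp (.add x y z) Q σ ↔ Q 1 (σ.setReg x (σ.reg y + σ.reg z)) :=
  ⟨by rintro ⟨_, _, ⟨⟩, h⟩; exact h, fun h => ⟨_, _, .add σ x y z, h⟩⟩

@[simp] theorem wp_sub : wp (.sub x y z) Q σ ↔ Q 1 (σ.setReg x (σ.reg y - σ.reg z)) :=
  ⟨by rintro ⟨_, _, ⟨⟩, h⟩; exact h, fun h => ⟨_, _, .sub σ x y z, h⟩⟩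

@[simp] theorem wp_load : wp (.load x y) Q σ ↔ Q 1 (σ.setReg x (σ.mem (σ.reg y))) :=
  ⟨by rintro ⟨_, _, ⟨⟩, h⟩; exact h, fun h => ⟨_, _, .load σ x y, h⟩⟩

@[simp] theorem wp_store : wp (.store x y) Q σ ↔ Q 1 (σ.setMem (σ.reg x) (σ.reg y)) :=
  ⟨by rintro ⟨_, _, ⟨⟩, h⟩; exact h, fun h => ⟨_, _, .store σ x y, h⟩⟩

@[simp] theorem wp_seq : wp (p ⨟ q) Q σ ↔ wp p (fun t => wp q fun u => Q (t + u)) σ := by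
  constructor
  · rintro ⟨_, _, hpq, h⟩
    cases hpq with
    | seq hp hq => exact ⟨_, _, hp, _, _, hq, h⟩
  · rintro ⟨t, τ, hp, u, ρ, hq, h⟩
    exact ⟨_, _, .seq hp hq, h⟩

@[simp] theorem wp_ifNZ : wp (.ifNZ x p q) Q σ ↔
    if σ.reg x = 0 then wp q (fun t => Q (t + 1)) σ else wp p (fun t => Q (t + 1)) σ := by
  split_ifs with hx
  · constructor
    · rintro ⟨_, _, hpq, h⟩
      cases hpq with
      | ifNZ_true hx' => exact absurd hx hx'
      | ifNZ_false _ hq => exact ⟨_, _, hq, h⟩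
    · rintro ⟨t, τ, hq, h⟩
      exact ⟨_, _, .ifNZ_false hx hq, h⟩
  · constructor
    · rintro ⟨_, _, hpq, h⟩
      cases hpq with
      | ifNZ_true _ hp => exact ⟨_, _, hp, h⟩
      | ifNZ_false hx' => exact absurd hx' hx
    · rintro ⟨t, τ, hp, h⟩
      exact ⟨_, _, .ifNZ_true hx hp, h⟩

theorem wp_whileNZ_of_eq_zero (hx : σ.reg x = 0) (h : Q 1 σ) : wp (.whileNZ x p) Q σ :=
  ⟨1, σ, .whileNZ_done hx, h⟩

theorem wp_whileNZ_of_ne_zero (hx : σ.reg x ≠ 0)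
    (h : wp p (fun t => wp (.whileNZ x p) fun u => Q (t + u + 1)) σ) : wp (.whileNZ x p) Q σ :=
  let ⟨_, _, hp, _, _, hw, h⟩ := h
  ⟨_, _, .whileNZ_step hx hp hw, h⟩

@[simp] theorem State.reg_setReg : (σ.setReg x a).reg y = if y = x then a else σ.reg y :=
  Function.update_apply ..

@[simp] theorem State.mem_setReg : (σ.setReg x a).mem = σ.mem := rfl

@[simp] theorem State.reg_setMem : (σ.setMem x a).reg = σ.reg := rfl

@[simp] theorem State.mem_setMem : (σ.setMem x a).mem = Function.update σ.mem x a := rfl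

/-- The program writes no register below `b`. -/
def Prog.Spares (b : ℕ) : Prog → Prop
  | .skip | .store _ _ => True
  | .const x _ | .copy x _ | .add x _ _ | .sub x _ _ | .load x _ => b ≤ x
  | .seq p q | .ifNZ _ p q => p.Spares b ∧ q.Spares b
  | .whileNZ _ p => p.Spares b

theorem Prog.Spares.mono (h : p.Spares b) (hab : a ≤ b) : p.Spares a := by
  induction p with
  | skip | store => trivial
  | const | copy | add | sub | load => exact hab.trans h
  | seq _ _ hp hq | ifNZ _ _ _ hp hq => exact ⟨hp h.1, hq h.2⟩
  | whileNZ _ _ hp => exact hp h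

@[simp] theorem State.setMem_setReg : (σ.setReg x a).setMem y b = (σ.setMem y b).setReg x a := rfl

theorem State.eqOn_setReg (hx : b ≤ x) : EqOn (σ.setReg x a).reg σ.reg (Iio b) := fun y hy => by
  rw [reg_setReg, if_neg ((mem_Iio.1 hy).trans_le hx).ne]

@[simp] theorem State.eqOn_setReg_left_iff {f : ℕ → ℕ} (hx : b ≤ x) :
    EqOn (σ.setReg x a).reg f (Iio b) ↔ EqOn σ.reg f (Iio b) :=
  ⟨(eqOn_setReg hx).symm.trans, (eqOn_setReg hx).trans⟩

@[simp] theorem State.eqOn_setReg_right_iff {f : ℕ → ℕ} (hx : b ≤ x) :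
    EqOn f (σ.setReg x a).reg (Iio b) ↔ EqOn f σ.reg (Iio b) :=
  ⟨fun h => h.trans (eqOn_setReg hx), fun h => h.trans (eqOn_setReg hx).symm⟩

theorem Exec.eqOn (h : Exec p σ t τ) (hp : p.Spares b) : EqOn τ.reg σ.reg (Iio b) := by
  induction h with
  | skip | store | whileNZ_done => exact eqOn_refl _ _
  | const | copy | add | sub | load => exact State.eqOn_setReg hp
  | seq _ _ h₁ h₂ => exact (h₂ hp.2).trans (h₁ hp.1)
  | ifNZ_true _ _ h => exact h hp.1
  | ifNZ_false _ _ h => exact h hp.2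
  | whileNZ_step _ _ _ h₁ h₂ => exact (h₂ hp).trans (h₁ hp)

theorem wp.frame (h : wp p Q σ) (hp : p.Spares b) :
    wp p (fun t τ => EqOn τ.reg σ.reg (Iio b) ∧ Q t τ) σ :=
  let ⟨t, τ, hE, hQ⟩ := h
  ⟨t, τ, hE, hE.eqOn hp, hQ⟩

end

/-! ### Loops -/

section

variable {one c r N T : ℕ} {p : Prog} {σ : State}

/-- Run `p` with the values `r - 1, …, 0` of the counter `c`. The register `one` has to hold `1`,
and `p` must not write `c`. -/
def countdown (one c r : ℕ) (p : Prog) : Prog :=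
  .copy c r ⨟ .whileNZ c (.sub c c one ⨟ p)

theorem wp_countdown {I : ℕ → State → Prop} (hp : p.Spares (c + 1)) (hc : one < c)
    (h1 : σ.reg one = 1) (hr : σ.reg r = N) (hI : ∀ i τ a, I i τ → I i (τ.setReg c a))
    (h0 : I N σ)
    (body : ∀ i < N, ∀ τ, EqOn τ.reg σ.reg (Iio c) → τ.reg c = i → I (i + 1) τ →
      wp p (fun t ρ => t ≤ T ∧ I i ρ) τ) :
    wp (countdown one c r p)
      (fun t τ => t ≤ N * (T + 2) + 2 ∧ EqOn τ.reg σ.reg (Iio c) ∧ I 0 τ) σ := by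
  have loop : ∀ i ≤ N, ∀ τ, EqOn τ.reg σ.reg (Iio c) → τ.reg c = i → I i τ →
      wp (.whileNZ c (.sub c c one ⨟ p))
        (fun t ρ => t ≤ i * (T + 2) + 1 ∧ EqOn ρ.reg σ.reg (Iio c) ∧ I 0 ρ) τ := by
    intro i
    induction i with
    | zero => exact fun _ τ heq hτ h => wp_whileNZ_of_eq_zero hτ ⟨by omega, heq, h⟩
    | succ i ih =>
      intro hi τ heq hτ h
      refine wp_whileNZ_of_ne_zero (by omega) ?_
      rw [wp_seq, wp_sub, hτ, heq hc, h1, Nat.add_sub_cancel]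
      have heq' : EqOn (τ.setReg c i).reg σ.reg (Iio c) := (State.eqOn_setReg le_rfl).trans heq
      refine ((body i hi _ heq' (by simp) (hI _ _ _ h)).frame hp).mono fun t ρ ⟨hρ, ht, h⟩ => ?_
      refine (ih (by omega) ρ ((hρ.mono (Iio_subset_Iio (Nat.le_succ c))).trans heq') ?_ h).mono
        fun u ρ' ⟨hu, h⟩ => ⟨by linarith, h⟩
      rw [hρ (mem_Iio.2 c.lt_succ_self)]
      simp
  rw [countdown, wp_seq, wp_copy, hr]
  exact (loop N le_rfl _ (State.eqOn_setReg le_rfl) (by simp) (hI _ _ _ h0)).mono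
    fun t τ ⟨ht, h⟩ => ⟨by linarith, h⟩

theorem wp_countdown_foldr {X Y : Type*} {R : ℕ → X → State → Prop} {f : Y → X → X} {l : List Y}
    {a : X} (hp : p.Spares (c + 1)) (hc : one < c) (h1 : σ.reg one = 1) (hr : σ.reg r = l.length)
    (hR : ∀ i a τ b, R i a τ → R i a (τ.setReg c b)) (h0 : R l.length a σ)
    (body : ∀ i (hi : i < l.length) a τ, EqOn τ.reg σ.reg (Iio c) → τ.reg c = i → R (i + 1) a τ →
      wp p (fun t ρ => t ≤ T ∧ R i (f l[i] a) ρ) τ) :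
    wp (countdown one c r p)
      (fun t τ => t ≤ l.length * (T + 2) + 2 ∧ EqOn τ.reg σ.reg (Iio c) ∧ R 0 (l.foldr f a) τ)
      σ := by
  refine (wp_countdown (I := fun i τ => R i ((l.drop i).foldr f a) τ) hp hc h1 hr
    (fun i τ b h => hR _ _ _ _ h) (by simpa using h0) fun i hi τ heq hτ h => ?_).mono
      fun t τ h => by simpa using h
  rw [List.drop_eq_getElem_cons hi]
  exact body i hi _ τ heq hτ h

end

end RAM

namespace NestSearch

open Set RAM Prog

/-! ### The search on a random access machine -/

/- Registers `0` to `2` are given by the input. A loop may only write registers above its counter,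
so the registers are numbered from the outside to the inside of the program. -/
namespace Reg

@[simp] abbrev n : ℕ := 0
@[simp] abbrev m : ℕ := 1
@[simp] abbrev k : ℕ := 2
@[simp] abbrev one : ℕ := 3
@[simp] abbrev count : ℕ := 4
@[simp] abbrev cur : ℕ := 5
@[simp] abbrev top : ℕ := 6
@[simp] abbrev start : ℕ := 7
@[simp] abbrev seed : ℕ := 8
@[simp] abbrev found : ℕ := 9
@[simp] abbrev round : ℕ := 10
@[simp] abbrev i : ℕ := 11
@[simp] abbrev rowE : ℕ := 12
@[simp] abbrev l : ℕ := 13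
@[simp] abbrev rowF : ℕ := 14
@[simp] abbrev guess : ℕ := 15
@[simp] abbrev plus : ℕ := 16
@[simp] abbrev minus : ℕ := 17
@[simp] abbrev j : ℕ := 18
@[simp] abbrev addr : ℕ := 19
@[simp] abbrev bitE : ℕ := 20
@[simp] abbrev bitF : ℕ := 21
@[simp] abbrev bitS : ℕ := 22
@[simp] abbrev meetsE : ℕ := 23
@[simp] abbrev meetsF : ℕ := 24
@[simp] abbrev onlyE : ℕ := 25
@[simp] abbrev onlyF : ℕ := 26
@[simp] abbrev size : ℕ := 27

end Reg

variable {α : Type*} {V : List α} {L : List (Set α)} {k : ℕ} {S S' A : Set α} {σ τ : State}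
  {mem : ℕ → ℕ} {a x : ℕ}

/-- The cells from the address `a` on hold the characteristic vector of `A`. -/
def CharVec (V : List α) (A : Set α) (mem : ℕ → ℕ) (a : ℕ) : Prop :=
  ∀ j (hj : j < V.length), mem (a + j) = A.indicator 1 V[j]

/-- In the incidence matrix a row that represents `e` starts at the address `a`. -/
def IsRow (V : List α) (L : List (Set α)) (e : Set α) (a : ℕ) : Prop :=
  ∃ i, ∃ hi : i < L.length, L[i] = e ∧ i * V.length = a

/-- The memory holds the incidence matrix, followed by the characteristic vector of the current
set `S`. -/
structure Layout (V : List α) (L : List (Set α)) (S : Set α) (mem : ℕ → ℕ) : Prop where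
  row : ∀ {e a}, IsRow V L e a → CharVec V e mem a
  cur : CharVec V S mem (L.length * V.length)

theorem Layout.congr (h : Layout V L S mem) (hS : ∀ x ∈ V, x ∈ S ↔ x ∈ S') : Layout V L S' mem where
  row := h.row
  cur j hj := by
    classical
    rw [h.cur j hj, indicator_apply, indicator_apply, if_congr (hS _ (V.getElem_mem hj)) rfl rfl]

theorem Layout.update (h : Layout V L S mem) (hV : V.Nodup) {j : ℕ} (hj : j < V.length)
    (hS : ∀ x ≠ V[j], x ∈ S' ↔ x ∈ S) :
    Layout V L S' (Function.update mem (L.length * V.length + j) (S'.indicator 1 V[j])) where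
  row := by
    rintro _ _ ⟨i, hi, rfl, rfl⟩ j' hj'
    have hlt : i * V.length + j' < L.length * V.length + j :=
      calc i * V.length + j' < (i + 1) * V.length := by rw [add_one_mul]; omega
        _ ≤ L.length * V.length := Nat.mul_le_mul_right _ hi
        _ ≤ L.length * V.length + j := Nat.le_add_right _ _
    rw [Function.update_of_ne hlt.ne, h.row ⟨i, hi, rfl, rfl⟩ j' hj']
  cur j' hj' := by
    classical
    obtain rfl | hne := eq_or_ne j' j
    · rw [Function.update_self]
    · rw [Function.update_of_ne (by omega), h.cur j' hj', indicator_apply, indicator_apply,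
        if_congr (hS _ (hV.getElem_inj_iff.not.2 hne)) rfl rfl]

/-- The input is in place, with current set `S`, which is empty at first. -/
structure Input (V : List α) (L : List (Set α)) (k : ℕ) (S : Set α) (σ : State) : Prop where
  reg_n : σ.reg Reg.n = V.length
  reg_m : σ.reg Reg.m = L.length
  reg_k : σ.reg Reg.k = k
  layout : Layout V L S σ.mem

theorem Input.setReg (h : Input V L k S σ) (hx : Reg.one ≤ x) : Input V L k S (σ.setReg x a) where
  reg_n := (State.eqOn_setReg hx (by simp)).trans h.reg_n
  reg_m := (State.eqOn_setReg hx (by simp)).trans h.reg_m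
  reg_k := (State.eqOn_setReg hx (by simp)).trans h.reg_k
  layout := h.layout

/-- In addition to the input, the constants are in place: `cur` is the first address after the
incidence matrix, and `top` is `2 ^ k`. -/
structure Env (V : List α) (L : List (Set α)) (k : ℕ) (S : Set α) (σ : State) : Prop
    extends Input V L k S σ where
  reg_one : σ.reg Reg.one = 1
  reg_cur : σ.reg Reg.cur = L.length * V.length
  reg_top : σ.reg Reg.top = 2 ^ k

theorem Env.of_eqOn (h : Env V L k S σ) (hreg : EqOn τ.reg σ.reg (Iio Reg.start))
    (hlayout : Layout V L S' τ.mem) : Env V L k S' τ where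
  reg_n := (hreg (by simp)).trans h.reg_n
  reg_m := (hreg (by simp)).trans h.reg_m
  reg_k := (hreg (by simp)).trans h.reg_k
  reg_one := (hreg (by simp)).trans h.reg_one
  reg_cur := (hreg (by simp)).trans h.reg_cur
  reg_top := (hreg (by simp)).trans h.reg_top
  layout := hlayout

@[simp] theorem Env.setReg_iff (hx : Reg.start ≤ x) :
    Env V L k S (σ.setReg x a) ↔ Env V L k S σ :=
  ⟨fun h => h.of_eqOn (State.eqOn_setReg hx).symm h.layout,
    fun h => h.of_eqOn (State.eqOn_setReg hx) h.layout⟩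

theorem Env.congr (h : Env V L k S σ) (hS : ∀ x ∈ V, x ∈ S ↔ x ∈ S') : Env V L k S' σ :=
  h.of_eqOn (eqOn_refl _ _) (h.layout.congr hS)

theorem Env.update (h : Env V L k S σ) (hV : V.Nodup) {j : ℕ} (hj : j < V.length)
    (hS : ∀ x ≠ V[j], x ∈ S' ↔ x ∈ S) (ha : S'.indicator 1 V[j] = a) :
    Env V L k S' (σ.setMem (L.length * V.length + j) a) :=
  h.of_eqOn (eqOn_refl _ _) (ha ▸ h.layout.update hV hj hS)

open Classical in
/-- The number of vertices of `A` in the columns from `i` on. -/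
noncomputable def countFrom (V : List α) (A : Set α) (i : ℕ) : ℕ := (V.drop i).countP (· ∈ A)

theorem countFrom_length : countFrom V A V.length = 0 := by simp [countFrom]

theorem countFrom_of_lt {i : ℕ} (hi : i < V.length) :
    countFrom V A i = countFrom V A (i + 1) + A.indicator 1 V[i] := by
  classical
  rw [countFrom, List.drop_eq_getElem_cons hi, List.countP_cons, indicator_apply]
  simp [countFrom]

theorem countFrom_zero (hV : V.Nodup) (hA : A ⊆ {x | x ∈ V}) : countFrom V A 0 = A.ncard := by
  classical
  have hfilter : A = ((V.filter (· ∈ A)).toFinset : Set α) := by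
    ext x
    simpa using @hA x
  conv_rhs => rw [hfilter, ncard_coe_finset, List.toFinset_card_of_nodup (hV.filter _)]
  rw [countFrom, List.drop_zero, List.countP_eq_length_filter]

theorem countFrom_zero_ne_zero (hA : A ⊆ {x | x ∈ V}) : countFrom V A 0 ≠ 0 ↔ A.Nonempty := by
  classical
  rw [countFrom, List.drop_zero, ← Nat.pos_iff_ne_zero, List.countP_pos_iff]
  exact ⟨fun ⟨x, _, hx⟩ => ⟨x, by simpa using hx⟩, fun ⟨x, hx⟩ => ⟨x, hA hx, by simpa using hx⟩⟩

/-- Put the entry in column `j` of the vector at the address `base` into the register `x`. -/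
def fetch (x base : ℕ) : Prog := .add Reg.addr base Reg.j ⨟ .load x Reg.addr

/-- Count the vertices in `e ∩ s`, `f ∩ s`, `(e \ f) \ s` and `(f \ e) \ s`, where `e` and `f` are
the edges in the rows `rowE` and `rowF`, and `s` is the current set. -/
def scan : Prog :=
  .const Reg.meetsE 0 ⨟ .const Reg.meetsF 0 ⨟ .const Reg.onlyE 0 ⨟ .const Reg.onlyF 0 ⨟
  countdown Reg.one Reg.j Reg.n
    (fetch Reg.bitE Reg.rowE ⨟ fetch Reg.bitF Reg.rowF ⨟ fetch Reg.bitS Reg.cur ⨟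
      .ifNZ Reg.bitS
        (.add Reg.meetsE Reg.meetsE Reg.bitE ⨟ .add Reg.meetsF Reg.meetsF Reg.bitF)
        (.sub Reg.addr Reg.bitE Reg.bitF ⨟ .add Reg.onlyE Reg.onlyE Reg.addr ⨟
          .sub Reg.addr Reg.bitF Reg.bitE ⨟ .add Reg.onlyF Reg.onlyF Reg.addr))

variable {e f : Set α}

theorem wp_scan (h : Env V L k S σ) (he : IsRow V L e (σ.reg Reg.rowE))
    (hf : IsRow V L f (σ.reg Reg.rowF)) :
    wp scan (fun t τ => t ≤ V.length * 13 + 6 ∧ EqOn τ.reg σ.reg (Iio Reg.j) ∧ τ.mem = σ.mem ∧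
      τ.reg Reg.meetsE = countFrom V (e ∩ S) 0 ∧ τ.reg Reg.meetsF = countFrom V (f ∩ S) 0 ∧
      τ.reg Reg.onlyE = countFrom V ((e \ f) \ S) 0 ∧
      τ.reg Reg.onlyF = countFrom V ((f \ e) \ S) 0) σ := by
  classical
  simp only [scan, wp_seq, wp_const]
  refine (wp_countdown (N := V.length) (T := 11) (I := fun i τ => τ.mem = σ.mem ∧
      τ.reg Reg.meetsE = countFrom V (e ∩ S) i ∧ τ.reg Reg.meetsF = countFrom V (f ∩ S) i ∧
      τ.reg Reg.onlyE = countFrom V ((e \ f) \ S) i ∧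
      τ.reg Reg.onlyF = countFrom V ((f \ e) \ S) i) (by simp [fetch, Spares]) (by simp)
      (by simpa using h.reg_one) (by simpa using h.reg_n) (by simp)
      (by simp [countFrom_length]) ?_).mono
      fun t τ ⟨ht, heq, h⟩ => ⟨by omega, by simpa using heq, h⟩
  rintro i hi τ heq hj ⟨hmem, hE, hF, hEF, hFE⟩
  have heq' : EqOn τ.reg σ.reg (Iio Reg.j) := by simpa using heq
  have hreg (x) (hx : x < Reg.j) : τ.reg x = σ.reg x := heq' hx
  have hbitE := h.layout.row he i hi
  have hbitF := h.layout.row hf i hi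
  have hbitS := h.layout.cur i hi
  by_cases hiE : V[i] ∈ e <;> by_cases hiF : V[i] ∈ f <;> by_cases hiS : V[i] ∈ S <;>
    simp [fetch, hreg, h.reg_cur, hj, hmem, hE, hF, hEF, hFE, hbitE, hbitF, hbitS, hiE, hiF, hiS,
      countFrom_of_lt hi]

/-- Count the vertices of the current set. -/
def measure : Prog :=
  .const Reg.size 0 ⨟
  countdown Reg.one Reg.j Reg.n (fetch Reg.bitS Reg.cur ⨟ .add Reg.size Reg.size Reg.bitS)

theorem wp_measure (h : Env V L k S σ) :
    wp measure (fun t τ => t ≤ V.length * 5 + 3 ∧ τ.mem = σ.mem ∧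
      τ.reg Reg.size = countFrom V S 0) σ := by
  simp only [measure, wp_seq, wp_const]
  refine (wp_countdown (N := V.length) (T := 3) (I := fun i τ => τ.mem = σ.mem ∧
      τ.reg Reg.size = countFrom V S i) (by simp [fetch, Spares]) (by simp)
      (by simpa using h.reg_one) (by simpa using h.reg_n) (by simp)
      (by simp [countFrom_length]) ?_).mono
      fun t τ ⟨ht, _, h⟩ => ⟨by omega, h⟩
  rintro i hi τ heq hj ⟨hmem, hsize⟩
  have hcur : τ.reg Reg.cur = σ.reg Reg.cur := by simpa using heq (x := Reg.cur) (by simp)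
  simp [fetch, hcur, h.reg_cur, hj, hmem, hsize, h.layout.cur i hi, countFrom_of_lt hi]

/-- Add the vertices of `e \ f` to the current set, where `e` and `f` are the edges in the rows
`plus` and `minus`. -/
def insertDiff : Prog :=
  countdown Reg.one Reg.j Reg.n
    (fetch Reg.bitE Reg.plus ⨟ fetch Reg.bitF Reg.minus ⨟ .sub Reg.bitE Reg.bitE Reg.bitF ⨟
      .ifNZ Reg.bitE (.add Reg.addr Reg.cur Reg.j ⨟ .store Reg.addr Reg.one) .skip)

theorem wp_insertDiff (hV : V.Nodup) (h : Env V L k S σ) (he : IsRow V L e (σ.reg Reg.plus))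
    (hf : IsRow V L f (σ.reg Reg.minus)) :
    wp insertDiff (fun t τ => t ≤ V.length * 10 + 2 ∧ EqOn τ.reg σ.reg (Iio Reg.j) ∧
      Env V L k (S ∪ e \ f) τ) σ := by
  refine (wp_countdown (N := V.length) (T := 8)
    (I := fun i τ => Env V L k (S ∪ {x ∈ e \ f | x ∈ V.drop i}) τ) (by simp [fetch, Spares])
    (by simp) h.reg_one h.reg_n (by simp) (by simpa using h) ?_).mono fun t τ ⟨ht, heq, h⟩ =>
      ⟨ht, heq, h.congr fun x hx => by simp [hx]⟩
  intro i hi τ heq hj hτ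
  have hplus : τ.reg Reg.plus = σ.reg Reg.plus := heq (by simp)
  have hminus : τ.reg Reg.minus = σ.reg Reg.minus := heq (by simp)
  have hbitE := hτ.layout.row he i hi
  have hbitF := hτ.layout.row hf i hi
  have hdrop (x) : x ∈ V.drop i ↔ x = V[i] ∨ x ∈ V.drop (i + 1) := by
    rw [List.drop_eq_getElem_cons hi, List.mem_cons]
  have hother (x) (hx : x ≠ V[i]) : x ∈ S ∪ {x ∈ e \ f | x ∈ V.drop i} ↔
      x ∈ S ∪ {x ∈ e \ f | x ∈ V.drop (i + 1)} := by
    simp [hdrop, hx]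
  by_cases hx : V[i] ∈ e \ f
  · have hnext := hτ.update hV hi hother (a := 1) (by simp [hdrop, hx.1, hx.2])
    simpa [fetch, hplus, hminus, hj, hbitE, hbitF, hx.1, hx.2, hτ.reg_cur, hτ.reg_one] using hnext
  · have hnext : Env V L k (S ∪ {x ∈ e \ f | x ∈ V.drop i}) τ := by
      refine hτ.congr fun x _ => ?_
      obtain rfl | hne := eq_or_ne x V[i]
      · rw [mem_union, mem_union]
        exact or_congr_right ⟨fun h => absurd h.1 hx, fun h => absurd h.1 hx⟩
      · exact (hother x hne).symm
    have hbit : e.indicator 1 V[i] - f.indicator 1 V[i] = 0 := by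
      by_cases hiE : V[i] ∈ e <;> by_cases hiF : V[i] ∈ f <;> simp_all
    simpa [fetch, hplus, hminus, hj, hbitE, hbitF, hbit] using hnext

/-- Make the current set empty. -/
def clear : Prog :=
  .const Reg.bitS 0 ⨟
  countdown Reg.one Reg.j Reg.n (.add Reg.addr Reg.cur Reg.j ⨟ .store Reg.addr Reg.bitS)

theorem wp_clear (hV : V.Nodup) (h : Env V L k S σ) :
    wp clear (fun t τ => t ≤ V.length * 4 + 3 ∧ EqOn τ.reg σ.reg (Iio Reg.j) ∧
      Env V L k ∅ τ) σ := by
  simp only [clear, wp_seq, wp_const]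
  refine (wp_countdown (N := V.length) (T := 2)
    (I := fun i τ => Env V L k (S \ {x | x ∈ V.drop i}) τ ∧ τ.reg Reg.bitS = 0)
    (by simp [Spares]) (by simp) (by simpa using h.reg_one) (by simpa using h.reg_n) (by simp)
    (by simpa using h) ?_).mono fun t τ ⟨ht, heq, h, _⟩ =>
      ⟨by omega, by simpa using heq, h.congr fun x hx => by simp [hx]⟩
  rintro i hi τ - hj ⟨hτ, hbit⟩
  have hdrop (x) : x ∈ V.drop i ↔ x = V[i] ∨ x ∈ V.drop (i + 1) := by
    rw [List.drop_eq_getElem_cons hi, List.mem_cons]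
  have hnext := hτ.update (S' := S \ {x | x ∈ V.drop i}) hV hi (a := 0)
    (fun x hx => by simp [hdrop, hx]) (by simp [hdrop])
  simpa [hj, hbit, hτ.reg_cur] using hnext

/-- Add `f \ e` or `e \ f` to the current set, depending on the leading binary digit of the guess,
where `e` and `f` are the edges in the rows `rowE` and `rowF`. -/
def extend : Prog :=
  .add Reg.guess Reg.guess Reg.guess ⨟ .sub Reg.addr Reg.top Reg.guess ⨟
  .ifNZ Reg.addr
    (.copy Reg.plus Reg.rowF ⨟ .copy Reg.minus Reg.rowE)
    (.sub Reg.guess Reg.guess Reg.top ⨟ .copy Reg.plus Reg.rowE ⨟ .copy Reg.minus Reg.rowF) ⨟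
  insertDiff

/-- The machine is at the stage `b` of the search. -/
def Rep (V : List α) (L : List (Set α)) (k : ℕ) (b : Branch α) (σ : State) : Prop :=
  Env V L k b.set σ ∧ σ.reg Reg.guess = b.guess

variable {b : Branch α}

theorem wp_extend (hV : V.Nodup) (h : Rep V L k b σ) (he : IsRow V L e (σ.reg Reg.rowE))
    (hf : IsRow V L f (σ.reg Reg.rowF)) (hc : Conflict b.set e f) :
    wp extend (fun t τ => t ≤ V.length * 10 + 8 ∧ Rep V L k (resolve (2 ^ k) e f b) τ) σ := by
  obtain ⟨h, hguess⟩ := h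
  have insert {g : ℕ} {e f : Set α} {τ : State} (hτ : Env V L k b.set τ)
      (hg : τ.reg Reg.guess = g) (he : IsRow V L e (τ.reg Reg.plus))
      (hf : IsRow V L f (τ.reg Reg.minus)) :
      wp insertDiff (fun t ρ => t ≤ V.length * 10 + 2 ∧ Rep V L k ⟨g, b.set ∪ e \ f⟩ ρ) τ :=
    (wp_insertDiff hV hτ he hf).mono fun t ρ ⟨ht, heq, h⟩ =>
      ⟨ht, h, (heq (by simp)).trans hg⟩
  rw [resolve, if_pos hc, two_mul]
  simp only [extend, wp_seq, wp_add, wp_sub, wp_ifNZ, wp_copy]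
  split_ifs with htop hlt hlt
  · exact absurd htop (by simp [h.reg_top, hguess]; omega)
  · refine (insert (by simpa using h) (by simp [hguess, h.reg_top]) (by simpa using he)
      (by simpa using hf)).mono fun t τ ⟨ht, h⟩ => ⟨by omega, h⟩
  · refine (insert (by simpa using h) (by simp [hguess]) (by simpa using hf)
      (by simpa using he)).mono fun t τ ⟨ht, h⟩ => ⟨by omega, h⟩
  · exact absurd htop (by simp [h.reg_top, hguess]; omega)

/-- If the edges in the rows `rowE` and `rowF` are in conflict, extend the current set. -/
def resolveProg : Prog :=
  scan ⨟ .ifNZ Reg.meetsE (.ifNZ Reg.meetsF (.ifNZ Reg.onlyE (.ifNZ Reg.onlyF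
    extend .skip) .skip) .skip) .skip

theorem wp_resolveProg (hV : V.Nodup) (hL : ∀ e ∈ L, e ⊆ {x | x ∈ V}) (h : Rep V L k b σ)
    (he : IsRow V L e (σ.reg Reg.rowE)) (hf : IsRow V L f (σ.reg Reg.rowF)) :
    wp resolveProg (fun t τ => t ≤ V.length * 23 + 18 ∧ Rep V L k (resolve (2 ^ k) e f b) τ) σ := by
  have subset {e : Set α} {a : ℕ} (he : IsRow V L e a) : e ⊆ {x | x ∈ V} := by
    obtain ⟨i, hi, rfl, -⟩ := he
    exact hL _ (L.getElem_mem hi)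
  rw [resolveProg, wp_seq]
  refine (wp_scan h.1 he hf).mono fun t τ ⟨ht, heq, hmem, hE, hF, hEF, hFE⟩ => ?_
  have hτ : Rep V L k b τ :=
    ⟨h.1.of_eqOn (heq.mono (Iio_subset_Iio (by simp))) (hmem ▸ h.1.layout),
      (heq (by simp)).trans h.2⟩
  have hconflict : Conflict b.set e f ↔ τ.reg Reg.meetsE ≠ 0 ∧ τ.reg Reg.meetsF ≠ 0 ∧
      τ.reg Reg.onlyE ≠ 0 ∧ τ.reg Reg.onlyF ≠ 0 := by
    rw [hE, hF, hEF, hFE, countFrom_zero_ne_zero (inter_subset_left.trans (subset he)),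
      countFrom_zero_ne_zero (inter_subset_left.trans (subset hf)),
      countFrom_zero_ne_zero ((sdiff_subset.trans sdiff_subset).trans (subset he)),
      countFrom_zero_ne_zero ((sdiff_subset.trans sdiff_subset).trans (subset hf)), Conflict]
  by_cases hc : Conflict b.set e f
  · obtain ⟨h₁, h₂, h₃, h₄⟩ := hconflict.1 hc
    simp only [wp_ifNZ, h₁, h₂, h₃, h₄, if_false]
    refine (wp_extend hV hτ ?_ ?_ hc).mono fun u ρ ⟨hu, hρ⟩ => ⟨by omega, hρ⟩
    · rwa [heq (by simp)]
    · rwa [heq (by simp)]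
  · rw [resolve_of_not_conflict hc]
    simp only [wp_ifNZ, wp_skip]
    split_ifs with h₁ h₂ h₃ h₄
    iterate 4 exact ⟨by omega, hτ⟩
    exact absurd (hconflict.2 ⟨h₁, h₂, h₃, h₄⟩) hc

theorem spares_resolveProg : resolveProg.Spares Reg.guess := by
  simp [resolveProg, scan, extend, insertDiff, fetch, countdown, Spares]

theorem Rep.setReg (h : Rep V L k b σ) (hx : Reg.start ≤ x) (hne : x ≠ Reg.guess) :
    Rep V L k b (σ.setReg x a) :=
  ⟨(Env.setReg_iff hx).2 h.1, by simpa [hne.symm] using h.2⟩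

/-- Resolve the conflicts of the edge in the row `rowE` with all edges. -/
def resolveRow : Prog :=
  .copy Reg.rowF Reg.cur ⨟
  countdown Reg.one Reg.l Reg.m (.sub Reg.rowF Reg.rowF Reg.n ⨟ resolveProg)

theorem wp_resolveRow (hV : V.Nodup) (hL : ∀ e ∈ L, e ⊆ {x | x ∈ V}) (h : Rep V L k b σ)
    (he : IsRow V L e (σ.reg Reg.rowE)) :
    wp resolveRow (fun t τ => t ≤ L.length * (V.length * 23 + 21) + 3 ∧
      Rep V L k (L.foldr (resolve (2 ^ k) e) b) τ) σ := by
  simp only [resolveRow, wp_seq, wp_copy]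
  refine (wp_countdown_foldr (T := V.length * 23 + 19)
    (R := fun i b τ => Rep V L k b τ ∧ τ.reg Reg.rowF = i * V.length)
    (by simp [Spares, spares_resolveProg.mono]) (by simp) (by simpa using h.1.reg_one)
    (by simpa using h.1.reg_m)
    (fun i b τ a h => ⟨h.1.setReg (by simp) (by simp), by simpa using h.2⟩)
    ⟨h.setReg (by simp) (by simp), by simpa using h.1.reg_cur⟩ ?_).mono
    fun t τ ⟨ht, _, h, _⟩ => ⟨by linarith, h⟩
  rintro i hi b τ heq - ⟨hτ, hrow⟩
  have hrowE : τ.reg Reg.rowE = σ.reg Reg.rowE := by simpa using heq (x := Reg.rowE) (by simp)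
  have hrowF : τ.reg Reg.rowF - τ.reg Reg.n = i * V.length := by
    rw [hrow, hτ.1.reg_n, add_one_mul, Nat.add_sub_cancel]
  rw [wp_seq, wp_sub, hrowF]
  have hstep := wp_resolveProg hV hL (e := e) (f := L[i])
    (hτ.setReg (x := Reg.rowF) (a := i * V.length) (by simp) (by simp))
    (by simpa [hrowE] using he) ⟨i, hi, rfl, by simp⟩
  refine (hstep.frame spares_resolveProg).mono
    fun t ρ ⟨hρ, ht, h⟩ => ⟨by omega, h, ?_⟩
  simpa using hρ (x := Reg.rowF) (by simp)

/-- Resolve the conflicts of all pairs of edges, one after the other. -/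
def sweepProg : Prog :=
  .copy Reg.rowE Reg.cur ⨟
  countdown Reg.one Reg.i Reg.m (.sub Reg.rowE Reg.rowE Reg.n ⨟ resolveRow)

theorem spares_resolveRow : resolveRow.Spares Reg.l := by
  simp [resolveRow, countdown, Spares, spares_resolveProg.mono]

/-- A bound on the running time of `sweepProg`. The bounds are written over an arbitrary semiring
in order to evaluate them at the polynomial `X`. -/
def sweepTime {R : Type*} [CommSemiring R] (n m : R) : R := m * (m * (n * 23 + 21) + 6) + 3

theorem wp_sweepProg (hV : V.Nodup) (hL : ∀ e ∈ L, e ⊆ {x | x ∈ V}) (h : Rep V L k b σ) :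
    wp sweepProg (fun t τ => t ≤ sweepTime V.length L.length ∧ Rep V L k (sweep (2 ^ k) L b) τ)
      σ := by
  simp only [sweepProg, wp_seq, wp_copy]
  refine (wp_countdown_foldr (T := L.length * (V.length * 23 + 21) + 4)
    (R := fun i b τ => Rep V L k b τ ∧ τ.reg Reg.rowE = i * V.length)
    (by simp [Spares, spares_resolveRow.mono]) (by simp) (by simpa using h.1.reg_one)
    (by simpa using h.1.reg_m)
    (fun i b τ a h => ⟨h.1.setReg (by simp) (by simp), by simpa using h.2⟩)
    ⟨h.setReg (by simp) (by simp), by simpa using h.1.reg_cur⟩ ?_).mono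
    fun t τ ⟨ht, _, h, _⟩ => ⟨by rw [sweepTime]; linarith, h⟩
  rintro i hi b τ - - ⟨hτ, hrow⟩
  have hrowE : τ.reg Reg.rowE - τ.reg Reg.n = i * V.length := by
    rw [hrow, hτ.1.reg_n, add_one_mul, Nat.add_sub_cancel]
  rw [wp_seq, wp_sub, hrowE]
  have hstep := wp_resolveRow hV hL (e := L[i])
    (hτ.setReg (x := Reg.rowE) (a := i * V.length) (by simp) (by simp)) ⟨i, hi, rfl, by simp⟩
  refine (hstep.frame spares_resolveRow).mono fun t ρ ⟨hρ, ht, h⟩ => ⟨by omega, h, ?_⟩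
  simpa using hρ (x := Reg.rowE) (by simp)

/-- Search with the starting vertex in the column `start` and the guess `seed`. -/
def searchProg : Prog :=
  clear ⨟ .add Reg.addr Reg.cur Reg.start ⨟ .store Reg.addr Reg.one ⨟
  .copy Reg.guess Reg.seed ⨟ countdown Reg.one Reg.round Reg.n sweepProg

/-- A bound on the running time of `searchProg`. -/
def searchTime {R : Type*} [CommSemiring R] (n m : R) : R := n * (sweepTime n m + 6) + 8

theorem spares_measure : measure.Spares Reg.j := by
  simp [measure, fetch, countdown, Spares]

theorem spares_sweepProg : sweepProg.Spares Reg.i := by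
  simp [sweepProg, countdown, Spares, spares_resolveRow.mono]

theorem wp_searchProg (hV : V.Nodup) (hL : ∀ e ∈ L, e ⊆ {x | x ∈ V}) (h : Env V L k S σ)
    {j : ℕ} (hj : j < V.length) (hstart : σ.reg Reg.start = j) :
    wp searchProg (fun t τ => t ≤ searchTime V.length L.length ∧
      Env V L k (search (2 ^ k) V L V[j] (σ.reg Reg.seed)).set τ) σ := by
  rw [searchProg, wp_seq]
  refine (wp_clear hV h).mono fun t τ ⟨ht, heq, hτ⟩ => ?_
  have hinit := hτ.update (S' := {V[j]}) (a := 1) hV hj (fun x hx => by simp [hx]) (by simp)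
  have hstart' : τ.reg Reg.start = j := (heq (by simp)).trans hstart
  have hseed : τ.reg Reg.seed = σ.reg Reg.seed := heq (by simp)
  simp only [wp_seq, wp_add, wp_store, wp_copy]
  refine (wp_countdown_foldr (l := V) (T := sweepTime V.length L.length)
    (R := fun _ => Rep V L k) (a := ⟨σ.reg Reg.seed, {V[j]}⟩) (spares_sweepProg.mono (by simp))
    (by simp) (by simpa using hτ.reg_one) (by simpa using hτ.reg_n)
    (fun _ b τ a h => h.setReg (by simp) (by simp)) ?_
    fun _ _ b τ _ _ hτ => wp_sweepProg hV hL hτ).mono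
    fun t τ ⟨ht, _, h⟩ => ⟨by rw [searchTime]; linarith, h.1⟩
  exact ⟨by simpa [hτ.reg_cur, hτ.reg_one, hstart'] using hinit, by simp [hseed]⟩

/-- Set `found` if the search with the starting vertex in the column `start` and the guess `seed`
leads to a set of at most `k` vertices. -/
def tryProg : Prog :=
  searchProg ⨟ measure ⨟ .sub Reg.addr Reg.size Reg.k ⨟
  .ifNZ Reg.addr .skip (.const Reg.found 1)

/-- A bound on the running time of `tryProg`. -/
def tryTime {R : Type*} [CommSemiring R] (n m : R) : R := searchTime n m + n * 5 + 6

theorem spares_searchProg : searchProg.Spares Reg.round := by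
  simp [searchProg, clear, countdown, Spares, spares_sweepProg.mono]

theorem spares_tryProg : tryProg.Spares Reg.found := by
  simp [tryProg, Spares, spares_searchProg.mono, spares_measure.mono]

variable {H : Hypergraph α} {F : Prop} {j : ℕ}

/-- Either the current set is a `k`-nest-set and `found` is set, or `found` is not set and the
attempts so far have failed as recorded by `F`. -/
def Status (H : Hypergraph α) (V : List α) (L : List (Set α)) (k : ℕ) (F : Prop) (σ : State) :
    Prop :=
  ∃ S, Env V L k S σ ∧ (σ.reg Reg.found = 1 ∧ H.IsKNestSet k S ∨ σ.reg Reg.found = 0 ∧ F)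

theorem Status.setReg (h : Status H V L k F σ) (hx : Reg.start ≤ x) (hne : x ≠ Reg.found) :
    Status H V L k F (σ.setReg x a) := by
  obtain ⟨S, hS, h⟩ := h
  exact ⟨S, (Env.setReg_iff hx).2 hS, by simpa [hne.symm] using h⟩

/-- No search with the starting vertex `v` and the guess `b` leads to a `k`-nest-set. -/
def Fails (H : Hypergraph α) (V : List α) (L : List (Set α)) (k : ℕ) (v : α) (b : ℕ) : Prop :=
  ¬ H.IsKNestSet k (search (2 ^ k) V L v b).set

theorem wp_tryProg (hl : Listing H V L) (h : Env V L k S σ) (hj : j < V.length)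
    (hstart : σ.reg Reg.start = j) (hfound : σ.reg Reg.found = 0) :
    wp tryProg (fun t τ => t ≤ tryTime V.length L.length ∧
      Status H V L k (Fails H V L k V[j] (σ.reg Reg.seed)) τ) σ := by
  set s := (search (2 ^ k) V L V[j] (σ.reg Reg.seed)).set
  have hsV : s ⊆ {x | x ∈ V} := hl.search_subset (V.getElem_mem hj)
  have hks : H.IsKNestSet k s ↔ s.ncard ≤ k := hl.isKNestSet_search_iff (V.getElem_mem hj)
  rw [tryProg, wp_seq]
  have hsearch := wp_searchProg hl.nodup (fun _ => hl.edge_subset) h hj hstart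
  refine (hsearch.frame (b := Reg.round) spares_searchProg).mono fun t τ ⟨hτσ, ht, hτ⟩ => ?_
  rw [wp_seq]
  refine ((wp_measure hτ).frame (b := Reg.j) spares_measure).mono
    fun u ρ ⟨hρτ, hu, hmem, hsize⟩ => ?_
  have hρ : Env V L k s ρ :=
    hτ.of_eqOn (hρτ.mono (Iio_subset_Iio (by simp))) (hmem ▸ hτ.layout)
  have hfoundρ : ρ.reg Reg.found = 0 := by
    rw [hρτ (by simp), hτσ (by simp), hfound]
  rw [countFrom_zero hl.nodup hsV] at hsize
  simp only [wp_seq, wp_sub, wp_ifNZ, wp_skip, wp_const]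
  split_ifs with hle
  · refine ⟨by rw [tryTime]; omega, s, by simpa using hρ, .inl ⟨by simp, hks.2 ?_⟩⟩
    simpa [hsize, hρ.reg_k, Nat.sub_eq_zero_iff_le] using hle
  · refine ⟨by rw [tryTime]; omega, s, by simpa using hρ, .inr ⟨by simpa using hfoundρ, ?_⟩⟩
    rw [Fails, hks]
    simpa [hsize, hρ.reg_k, Nat.sub_eq_zero_iff_le] using hle

theorem foldr_and_iff {Y : Type*} {p : Y → Prop} {l : List Y} :
    l.foldr (fun y F => p y ∧ F) F ↔ (∀ y ∈ l, p y) ∧ F := by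
  induction l with
  | nil => simp
  | cons y l ih => rw [List.foldr_cons, ih, List.forall_mem_cons, and_assoc]

/-- Try all guesses with the starting vertex in the column `start`. -/
def trySeeds : Prog := countdown Reg.one Reg.seed Reg.top (.ifNZ Reg.found .skip tryProg)

theorem wp_trySeeds (hl : Listing H V L) (h : Status H V L k F σ) (hj : j < V.length)
    (hstart : σ.reg Reg.start = j) :
    wp trySeeds (fun t τ => t ≤ 2 ^ k * (tryTime V.length L.length + 3) + 2 ∧
      Status H V L k ((∀ b < 2 ^ k, Fails H V L k V[j] b) ∧ F) τ) σ := by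
  obtain ⟨S, hS, -⟩ := id h
  refine (wp_countdown_foldr (l := List.range (2 ^ k)) (a := F)
    (f := fun b F => Fails H V L k V[j] b ∧ F) (T := tryTime V.length L.length + 1)
    (R := fun _ => Status H V L k) (by simp [Spares, spares_tryProg.mono]) (by simp) hS.reg_one
    (by simpa using hS.reg_top) (fun _ F τ a h => h.setReg (by simp) (by simp)) h ?_).mono
    fun t τ ⟨ht, _, hτ⟩ => ⟨by simpa using ht, by simpa [foldr_and_iff] using hτ⟩
  rintro b hb F τ heq hseed ⟨S, hS, hstatus⟩
  rw [wp_ifNZ]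
  split_ifs with hfound
  · have hF : F := by simpa [hfound] using hstatus
    have htry := wp_tryProg hl hS hj ((heq (by simp)).trans hstart) hfound
    refine htry.mono fun t ρ ⟨ht, S, hS, hρ⟩ => ⟨by omega, S, hS, ?_⟩
    rw [hseed] at hρ
    simpa [hF] using hρ
  · rw [wp_skip]
    refine ⟨by rw [tryTime]; omega, S, hS, ?_⟩
    simpa [hfound] using hstatus

/-- Try all starting vertices and all guesses. -/
def tryAll : Prog := .const Reg.found 0 ⨟ countdown Reg.one Reg.start Reg.n trySeeds

theorem spares_trySeeds : trySeeds.Spares Reg.seed := by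
  simp [trySeeds, countdown, Spares, spares_tryProg.mono]

theorem wp_tryAll (hl : Listing H V L) (h : Env V L k S σ) :
    wp tryAll (fun t τ => t ≤ V.length * (2 ^ k * (tryTime V.length L.length + 3) + 4) + 3 ∧
      Status H V L k (¬ ∃ s, H.IsKNestSet k s) τ) σ := by
  simp only [tryAll, wp_seq, wp_const]
  refine (wp_countdown_foldr (l := V) (a := True)
    (f := fun v F => (∀ b < 2 ^ k, Fails H V L k v b) ∧ F)
    (R := fun _ => Status H V L k) (spares_trySeeds.mono (by simp)) (by simp)
    (by simpa using h.reg_one) (by simpa using h.reg_n)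
    (fun _ F τ a h => h.setReg (by simp) (by simp))
    ⟨S, by simpa using h, .inr ⟨by simp, trivial⟩⟩
    fun i hi F τ _ hstart hτ => wp_trySeeds hl hτ hi hstart).mono
    fun t τ ⟨ht, _, hτ⟩ => ⟨by linarith, ?_⟩
  have hfails : (∀ v ∈ V, ∀ b < 2 ^ k, Fails H V L k v b) ↔ ¬ ∃ s, H.IsKNestSet k s := by
    rw [hl.exists_isKNestSet_iff]
    simp [Fails]
  rwa [foldr_and_iff, and_true, hfails] at hτ

/-- Put `1` into the register `one` and the product of `m` and `n` into the register `cur`. -/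
def initCur : Prog :=
  .const Reg.one 1 ⨟ .const Reg.cur 0 ⨟
  countdown Reg.one Reg.count Reg.m (.add Reg.cur Reg.cur Reg.n)

theorem wp_initCur (h : Input V L k S σ) :
    wp initCur (fun t τ => t ≤ L.length * 3 + 4 ∧ Input V L k S τ ∧ τ.reg Reg.one = 1 ∧
      τ.reg Reg.cur = L.length * V.length) σ := by
  simp only [initCur, wp_seq, wp_const]
  refine (wp_countdown (N := L.length) (T := 1) (I := fun i τ => Input V L k S τ ∧
    τ.reg Reg.one = 1 ∧ τ.reg Reg.cur + i * V.length = L.length * V.length) (by simp [Spares])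
    (by simp) (by simp) (by simpa using h.reg_m)
    (fun i τ a ⟨h, hτ⟩ => ⟨h.setReg (by simp), by simpa using hτ⟩)
    ⟨(h.setReg le_rfl).setReg (by simp), by simp⟩ ?_).mono
    fun t τ ⟨ht, _, hτ, hone, hcur⟩ => ⟨by omega, hτ, hone, by simpa using hcur⟩
  rintro i - τ - - ⟨hτ, hone, hcur⟩
  rw [wp_add, hτ.reg_n]
  refine ⟨le_rfl, hτ.setReg (by simp), by simpa using hone, ?_⟩
  simp only [State.reg_setReg, if_true]
  linarith

/-- Put `2 ^ k` into the register `top`. -/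
def initTop : Prog :=
  .const Reg.top 1 ⨟ countdown Reg.one Reg.count Reg.k (.add Reg.top Reg.top Reg.top)

theorem wp_initTop (h : Input V L k S σ) (hone : σ.reg Reg.one = 1)
    (hcur : σ.reg Reg.cur = L.length * V.length) :
    wp initTop (fun t τ => t ≤ k * 3 + 3 ∧ Env V L k S τ) σ := by
  simp only [initTop, wp_seq, wp_const]
  refine (wp_countdown (N := k) (T := 1) (I := fun i τ => Input V L k S τ ∧
    τ.reg Reg.one = 1 ∧ τ.reg Reg.cur = L.length * V.length ∧ τ.reg Reg.top * 2 ^ i = 2 ^ k)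
    (by simp [Spares]) (by simp) (by simpa using hone) (by simpa using h.reg_k)
    (fun i τ a ⟨h, hτ⟩ => ⟨h.setReg (by simp), by simpa using hτ⟩)
    ⟨h.setReg (by simp), by simpa using ⟨hone, hcur⟩⟩ ?_).mono
    fun t τ ⟨ht, _, hτ, hone, hcur, htop⟩ => ⟨by omega, hτ, hone, hcur, by simpa using htop⟩
  rintro i - τ - - ⟨hτ, hone, hcur, htop⟩
  rw [wp_add]
  refine ⟨le_rfl, hτ.setReg (by simp), by simpa using hone, by simpa using hcur, ?_⟩
  simp only [State.reg_setReg, if_true]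
  rw [← htop]
  ring

/-- The algorithm. The characteristic vector of a nest-set that was found is returned in the place
after the incidence matrix. -/
def prog : Prog := initCur ⨟ initTop ⨟ tryAll ⨟ .copy 0 Reg.found ⨟ .copy 1 Reg.cur

/-- The polynomial factor in the bound on the running time of `prog`. -/
def progTime {R : Type*} [CommSemiring R] (n m : R) : R := n * (tryTime n m + 7) + m * 3 + 15

theorem wp_prog (hl : Listing H V L) (h : Input V L k ∅ σ) :
    wp prog (fun t τ => t ≤ 2 ^ k * progTime V.length L.length ∧
      ((∃ s, H.IsKNestSet k s ∧ τ.reg 0 = 1 ∧ CharVec V s τ.mem (τ.reg 1)) ∨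
        (¬ ∃ s, H.IsKNestSet k s) ∧ τ.reg 0 = 0)) σ := by
  rw [prog, wp_seq]
  refine (wp_initCur h).mono fun t₁ σ₁ ⟨ht₁, hσ₁, hone, hcur⟩ => ?_
  rw [wp_seq]
  refine (wp_initTop hσ₁ hone hcur).mono fun t₂ σ₂ ⟨ht₂, hσ₂⟩ => ?_
  rw [wp_seq]
  refine (wp_tryAll hl hσ₂).mono fun t₃ σ₃ ⟨ht₃, s, hσ₃, hs⟩ => ?_
  have htime : t₁ + (t₂ + (t₃ + 2)) ≤ 2 ^ k * progTime V.length L.length := by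
    have h1 : 1 ≤ 2 ^ k := Nat.one_le_two_pow
    have hk : k ≤ 2 ^ k := Nat.lt_two_pow_self.le
    rw [progTime]
    nlinarith
  simp only [wp_seq, wp_copy]
  refine ⟨htime, hs.imp (fun ⟨hfound, hs⟩ => ⟨s, hs, ?_⟩) fun ⟨hfound, hs⟩ => ⟨hs, ?_⟩⟩
  · simpa [hfound, hσ₃.reg_cur] using hσ₃.layout.cur
  · simp [hfound]

section Encoding

variable {n m : ℕ} (vs : Fin n ≃ H.vertexSet) (es : Fin m ≃ H.edgeSet)

/-- The vertices in the order of the columns of the incidence matrix. -/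
def vertexList : List α := List.ofFn fun j => (vs j : α)

/-- The edges in the order of the rows of the incidence matrix. -/
def edgeList : List (Set α) := List.ofFn fun i => (es i : Set α)

@[simp] theorem length_vertexList : (vertexList vs).length = n := List.length_ofFn

@[simp] theorem length_edgeList : (edgeList es).length = m := List.length_ofFn

@[simp] theorem getElem_vertexList (hj : j < (vertexList vs).length) :
    (vertexList vs)[j] = vs ⟨j, by simpa using hj⟩ := List.getElem_ofFn hj

@[simp] theorem getElem_edgeList {i : ℕ} (hi : i < (edgeList es).length) :
    (edgeList es)[i] = es ⟨i, by simpa using hi⟩ := List.getElem_ofFn hi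

theorem listing_vertexList_edgeList : Listing H (vertexList vs) (edgeList es) where
  nodup := List.nodup_ofFn.2 (Subtype.val_injective.comp vs.injective)
  mem_vertices {x} := by
    rw [vertexList, List.mem_ofFn]
    exact ⟨by rintro ⟨j, rfl⟩; exact (vs j).2, fun hx => ⟨vs.symm ⟨x, hx⟩, by simp⟩⟩
  mem_edges {e} := by
    rw [edgeList, List.mem_ofFn]
    exact ⟨by rintro ⟨i, rfl⟩; exact (es i).2, fun he => ⟨es.symm ⟨e, he⟩, by simp⟩⟩

theorem mul_add_inj {i i' : Fin m} {j j' : Fin n} :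
    (i * n + j : ℕ) = i' * n + j' ↔ i = i' ∧ j = j' := by
  refine ⟨fun h => ?_, by rintro ⟨rfl, rfl⟩; rfl⟩
  have hij : finProdFinEquiv (i, j) = finProdFinEquiv (i', j') := by
    ext
    simpa [add_comm, mul_comm] using h
  simpa using hij

theorem mem_inputState (i : Fin m) (j : Fin n) :
    (H.inputState vs es k).mem (i * n + j) = (es i : Set α).indicator 1 (vs j : α) := by
  classical
  simp [Hypergraph.inputState, mul_add_inj, indicator_apply]

theorem mem_inputState_eq_zero (ha : m * n ≤ a) : (H.inputState vs es k).mem a = 0 := by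
  refine if_neg ?_
  rintro ⟨i, j, rfl, -⟩
  have hlt : i * n + j < m * n :=
    calc i * n + j < (i + 1) * n := by rw [add_one_mul]; omega
      _ ≤ m * n := Nat.mul_le_mul_right n i.2
  exact ha.not_gt hlt

theorem input_inputState : Input (vertexList vs) (edgeList es) k ∅ (H.inputState vs es k) where
  reg_n := by simp [Hypergraph.inputState]
  reg_m := by simp [Hypergraph.inputState]
  reg_k := by simp [Hypergraph.inputState]
  layout := by
    refine ⟨?_, fun j hj => ?_⟩
    · rintro _ _ ⟨i, hi, rfl, rfl⟩ j hj
      have hcell := mem_inputState (k := k) vs es ⟨i, by simpa using hi⟩ ⟨j, by simpa using hj⟩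
      simpa using hcell
    · simp [mem_inputState_eq_zero]

theorem returns_of_charVec {s : Set α} (h0 : σ.reg 0 = 1)
    (h : CharVec (vertexList vs) s σ.mem (σ.reg 1)) : H.Returns vs σ s := by
  refine ⟨h0, fun j => ?_⟩
  have hj := h j (by simp)
  rw [getElem_vertexList, Fin.eta] at hj
  rw [hj]
  exact ⟨fun h => indicator_of_mem h 1, fun h => indicator_of_notMem h 1⟩

include vs es in
theorem size_eq : H.size = n + m := by
  rw [Hypergraph.size, ← Nat.card_coe_set_eq, ← Nat.card_coe_set_eq, ← Nat.card_congr vs,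
    ← Nat.card_congr es, Nat.card_fin, Nat.card_fin]

end Encoding

theorem progTime_le_eval (n m : ℕ) :
    progTime n m ≤ (progTime Polynomial.X Polynomial.X : Polynomial ℕ).eval (n + m) := by
  have heval : (progTime Polynomial.X Polynomial.X : Polynomial ℕ).eval (n + m) =
      progTime (n + m) (n + m) := by
    simp [progTime, tryTime, searchTime, sweepTime]
  rw [heval]
  simp only [progTime, tryTime, searchTime, sweepTime]
  gcongr <;> omega

end NestSearch

theorem theorem5p6_general :
    ∃ (P : RAM.Prog) (p : Polynomial ℕ),
      ∀ (α : Type*) (H : Hypergraph α) (n m : ℕ)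
        (vs : Fin n ≃ H.vertexSet) (es : Fin m ≃ H.edgeSet) (k : ℕ),
        ∃ (t : ℕ) (σ : RAM.State),
          RAM.Exec P (H.inputState vs es k) t σ ∧
          t ≤ 2 ^ k * p.eval H.size ∧
          ((∃ s : Set α, H.IsKNestSet k s) →
            ∃ s : Set α, H.IsKNestSet k s ∧ H.Returns vs σ s) ∧
          ((¬ ∃ s : Set α, H.IsKNestSet k s) → Hypergraph.Rejects σ) := by
  refine ⟨NestSearch.prog, NestSearch.progTime .X .X, fun α H n m vs es k => ?_⟩
  obtain ⟨t, σ, hexec, ht, h⟩ := NestSearch.wp_prog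
    (NestSearch.listing_vertexList_edgeList vs es) (NestSearch.input_inputState (k := k) vs es)
  rw [NestSearch.length_vertexList, NestSearch.length_edgeList] at ht
  refine ⟨t, σ, hexec, ?_, fun hex => ?_, fun hnex => ?_⟩
  · rw [NestSearch.size_eq vs es]
    exact ht.trans (Nat.mul_le_mul_left _ (NestSearch.progTime_le_eval n m))
  · obtain ⟨s, hs, h0, hvec⟩ := h.resolve_right fun hnex => hnex.1 hex
    exact ⟨s, hs, NestSearch.returns_of_charVec vs h0 hvec⟩
  · exact (h.resolve_left fun ⟨s, hs, _⟩ => hnex ⟨s, hs⟩).2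

/-- There are one program `P`, one constant `c` and one polynomial `p` such that for every finite
hypergraph `H` (with its vertices and its edges listed in any order) and every `k ≥ 1`, the program
halts on `(H, k)` within `2 ^ (c * k ^ 2) * p(‖H‖)` steps, and returns a `k`-nest-set of `H` if
there is one, and rejects if there is none. -/
theorem theorem5p6 :
    ∃ (P : RAM.Prog) (c : ℕ) (p : Polynomial ℕ),
      ∀ (α : Type*) (H : Hypergraph α) (n m : ℕ)
        (vs : Fin n ≃ H.vertexSet) (es : Fin m ≃ H.edgeSet) (k : ℕ), 1 ≤ k →
        ∃ (t : ℕ) (σ : RAM.State),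
          RAM.Exec P (H.inputState vs es k) t σ ∧
          t ≤ 2 ^ (c * k ^ 2) * p.eval H.size ∧
          ((∃ s : Set α, H.IsKNestSet k s) →
            ∃ s : Set α, H.IsKNestSet k s ∧ H.Returns vs σ s) ∧
          ((¬ ∃ s : Set α, H.IsKNestSet k s) → Hypergraph.Rejects σ) := by
  obtain ⟨P, p, h⟩ := theorem5p6_general
  refine ⟨P, 1, p, fun α H n m vs es k _ => ?_⟩
  obtain ⟨t, σ, hexec, ht, hσ⟩ := h α H n m vs es k
  have hk : k ≤ 1 * k ^ 2 := by nlinarith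
  exact ⟨t, σ, hexec, ht.trans (by gcongr; norm_num), hσ⟩
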